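/- Let $B_4$ be the 4-strand braid group with Artin generators $\sigma_1,\sigma_2,\sigma_3$, and consider its Gorin–Lin generators $$t=\sigma_1,\quad t_1=\sigma_1\sigma_2\sigma_1^{-2},\quad t_2=\sigma_2\sigma_1^{-1},\quad a=\sigma_1\sigma_2\sigma_1^{-1}\sigma_3\sigma_2^{-1}\sigma_1^{-1},\quad b=\sigma_3\sigma_1^{-1}.$$ Let $X=\{t,t_1,t_2,a,b\}^{\pm1}$. A word $t^pVW\in X^*$ representing $\beta\in B_4$, where $p\in\mathbb Z$, $V$ is a freely reduced group word over $\{t_1,t_2\}$ and $W$ is a freely reduced group word over $\{a,b\}$, is called an HNN normal form of $\beta$. A function $f:A^*\to Y^*$ ($A,Y$ finite alphabets) is logspace computable if there are a constant $c$ and a deterministic transducer (finite control, two-way read-only input tape with end markers, read-write work tape, write-only output tape) that on every input $w\in A^*$ halts with output $f(w)$ and uses at most $c(\lfloor\log_2|w|\rfloor+1)$ squares of the work tape (with $\lfloor\log_2 0\rfloor$ read as $0$). Theorem. (1) Every $\beta\in B_4$ has exactly one HNN normal form. (2) For every $m\in\mathbb N$, the HNN normal form of $b^{t_1^m}=t_1^{-m}bt_1^m$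 has length $\Phi^{2m+1}-\Phi^{-(2m+1)}$, where $\Phi=(1+\sqrt5)/2$; so its length is exponential in $m$. (3) The HNN normal form is not logspace computable: the function $X^*\to X^*$ that sends a word to the HNN normal form of the braid it represents is not logspace computable. More generally, for every finite alphabet $A$ and every map $A\to B_4$ whose image generates $B_4$ as a monoid (for instance $A=\{\sigma_1,\sigma_2,\sigma_3\}^{\pm1}$), the function $A^*\to X^*$ that sends a word to the HNN normal form of the braid it represents is not logspace computable. -/

import Mathlib

/-! ## Deterministic logspace transducers -/

namespace Logspace

/-- What the read-only head sees: one of the two end markers, or a letter of the input word. -/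
inductive InputSymbol (A : Type) where
  | leftEnd : InputSymbol A
  | letter (x : A) : InputSymbol A
  | rightEnd : InputSymbol A

/-- Head movements. -/
inductive Move where
  | left
  | stay
  | right

/-- A deterministic transducer with a finite state control, a read-only input tape (alphabet `A`),
a read-write work tape and a write-only output tape (alphabet `B`). The transition function sees
the state, the scanned input symbol and the scanned work symbol; it either halts (`none`) or gives
the new state, the symbol to write on the work tape, the moves of the input and work heads, and
the finite word to append to the output. As states and alphabets are finite, at most a fixed number
of letters is printed in one transition. -/
structure Transducer (A B : Type) where
  State : Type
  Work : Type
  finite_state : Finite State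
  finite_work : Finite Work
  start : State
  blank : Work
  trans : State → InputSymbol A → Work → Option (State × Work × Move × Move × List B)

/-- A configuration. The input head is at a position in `0, …, n + 1` (where `0` and `n + 1` carry
the end markers); the work tape is infinite to the right, with cells indexed by `ℕ`. -/
structure Config {A B : Type} (M : Transducer A B) where
  state : M.State
  inputPos : ℕ
  tape : ℕ → M.Work
  workPos : ℕ
  output : List B

/-- The symbol at position `i` of the input tape holding `w`. -/
def readInput {A : Type} (w : List A) (i : ℕ) : InputSymbol A :=
  if i = 0 then .leftEnd
  else match w[i - 1]? with
    | some x => .letter x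
    | none => .rightEnd

/-- Moving the input head, which never leaves `0, …, n + 1`. -/
def moveInput (n i : ℕ) : Move → ℕ
  | .left => i - 1
  | .stay => i
  | .right => min (i + 1) (n + 1)

/-- Moving the work head; a left move in cell `0` has no effect. -/
def moveWork (i : ℕ) : Move → ℕ
  | .left => i - 1
  | .stay => i
  | .right => i + 1

/-- The initial configuration: input head on the left end marker, blank work tape, empty output. -/
def init {A B : Type} (M : Transducer A B) : Config M where
  state := M.start
  inputPos := 0
  tape := fun _ => M.blank
  workPos := 0
  output := []

/-- One step of the machine on the input word `w`; `none` means that the machine has halted. -/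
def step {A B : Type} (M : Transducer A B) (w : List A) (c : Config M) : Option (Config M) :=
  (M.trans c.state (readInput w c.inputPos) (c.tape c.workPos)).map
    fun (q, x, mi, mw, out) =>
      { state := q
        inputPos := moveInput w.length c.inputPos mi
        tape := Function.update c.tape c.workPos x
        workPos := moveWork c.workPos mw
        output := c.output ++ out }

/-- On input `w`, the machine halts and its output tape then holds exactly `u`. -/
def Computes {A B : Type} (M : Transducer A B) (w : List A) (u : List B) : Prop :=
  ∃ c : Config M, StateTransition.Reaches (step M w) (init M) c ∧ step M w c = none ∧ c.output = u

/-- On input `w`, the work head stays within the first `s` cells of the work tape. -/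
def UsesSpace {A B : Type} (M : Transducer A B) (w : List A) (s : ℕ) : Prop :=
  ∀ c : Config M, StateTransition.Reaches (step M w) (init M) c → c.workPos < s

/-- `f` is logspace computable: some deterministic transducer computes `f w` on every input `w`,
using at most `c (⌊log₂ |w|⌋ + 1)` work cells for a constant `c`. The summand `1` allows a bounded
amount of space on inputs of length at most `1`. -/
def LogspaceComputable {A B : Type} (f : List A → List B) : Prop :=
  ∃ (M : Transducer A B) (c : ℕ), ∀ w : List A,
    Computes M w (f w) ∧ UsesSpace M w (c * (Nat.log 2 w.length + 1))

end Logspace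

/-! ## The 4-strand braid group and the HNN normal form -/

namespace Braid4

/-- Artin's relations for the generators `σ₁, σ₂, σ₃` (indexed by `0, 1, 2`). -/
def artinRels : Set (FreeGroup (Fin 3)) :=
  let s : Fin 3 → FreeGroup (Fin 3) := FreeGroup.of
  { s 0 * s 1 * s 0 * (s 1 * s 0 * s 1)⁻¹,
    s 1 * s 2 * s 1 * (s 2 * s 1 * s 2)⁻¹,
    s 0 * s 2 * (s 2 * s 0)⁻¹ }

/-- The 4-strand braid group, in Artin's presentation. -/
abbrev B4 : Type := PresentedGroup artinRels

/-- The Artin generator `σ₁`. -/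
def σ₁ : B4 := PresentedGroup.of 0
/-- The Artin generator `σ₂`. -/
def σ₂ : B4 := PresentedGroup.of 1
/-- The Artin generator `σ₃`. -/
def σ₃ : B4 := PresentedGroup.of 2

/-- Names of the five Gorin–Lin generators of the 4-strand braid group. -/
inductive GorinLin where
  | t | t₁ | t₂ | a | b

/-- The braids denoted by the Gorin–Lin generators. -/
def GorinLin.braid : GorinLin → B4
  | .t => σ₁
  | .t₁ => σ₁ * σ₂ * σ₁⁻¹ * σ₁⁻¹
  | .t₂ => σ₂ * σ₁⁻¹
  | .a => σ₁ * σ₂ * σ₁⁻¹ * σ₃ * σ₂⁻¹ * σ₁⁻¹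
  | .b => σ₃ * σ₁⁻¹

/-- Letters `x^{±1}` with `x` a Gorin–Lin generator; as in `FreeGroup`, `(x, true)` stands for `x`
and `(x, false)` for `x⁻¹`. -/
abbrev Letter : Type := GorinLin × Bool

/-- The braid denoted by a letter. -/
def letterBraid (x : Letter) : B4 := if x.2 then x.1.braid else x.1.braid⁻¹

/-- The element of a group that is represented by a word over `A`, for an evaluation `g` of the
letters. -/
def evalWord {A G : Type} [Group G] (g : A → G) (w : List A) : G := (w.map g).prod

/-- The word `t^p`. -/
def tPow (p : ℤ) : List Letter := List.replicate p.natAbs (GorinLin.t, decide (0 ≤ p))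

/-- `u` is an HNN normal form of the braid `β`: it is a word `t^p V W` representing `β`, with
`p : ℤ`, `V` a reduced group word over `{t₁, t₂}` and `W` a reduced group word over `{a, b}`. -/
def IsHNNNormalForm (u : List Letter) (β : B4) : Prop :=
  ∃ (p : ℤ) (V W : List Letter),
    (∀ x ∈ V, x.1 = GorinLin.t₁ ∨ x.1 = GorinLin.t₂) ∧ FreeGroup.IsReduced V ∧
    (∀ x ∈ W, x.1 = GorinLin.a ∨ x.1 = GorinLin.b) ∧ FreeGroup.IsReduced W ∧
    u = tPow p ++ V ++ W ∧ evalWord letterBraid u = β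

end Braid4

/-! The braid group is an iterated semidirect product `F₂ ⋊ (F₂ ⋊ ℤ)`: `⟨a, b⟩` is normal, with
complement `⟨t₁, t₂⟩ ⋊ ⟨t⟩`. Existence of the factorization `t^p v w` follows from Artin's
relations: `σ₁` normalizes `⟨t₁, t₂⟩`, every braid normalizes `⟨a, b⟩` (`conj_fiberIncl`), and `σ₂ =
t₂ t`, `σ₃ = b t`.

Uniqueness (`factorization_injective`) needs the freeness of both subgroups, which is detected by
two explicit actions of `B4` on `F₂`. On the relevant subgroup each action is by inner
automorphisms, and these determine the element because `F₂` has trivial centre. The exponent sum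
determines `p`.

Conjugation by `t₁⁻¹` sends `b` to `b a⁻¹ b b` and `a` to `b`. Iterated on `b`, it yields words in
`a⁻¹` and `b` only, so nothing cancels and the lengths are Lucas numbers
(`exists_words_fiberAction_pow`). A logspace machine has polynomially many configurations up to
output and never repeats one before halting, so its output is polynomially long
(`LogspaceComputable.exists_length_le`). Inputs of linear length representing `t₁⁻ᵐ b t₁ᵐ`
contradict this. -/

namespace FreeGroup

/-- If the reduced word of `w` begins with a power of the generator `i`, take `j ≠ i`. Then `j w` is
reduced, so `w j`, of the same length, cannot cancel either; the two words coincide, yet they begin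
with different generators. -/
theorem eq_one_of_commute_of {α : Type*} [DecidableEq α] [Nontrivial α] {w : FreeGroup α}
    (h : ∀ i, w * of i = of i * w) : w = 1 := by
  by_contra hw
  have hL : w.toWord ≠ [] := by simpa using hw
  obtain ⟨⟨i, s⟩, L, hL⟩ := List.exists_cons_of_ne_nil hL
  obtain ⟨j, hj⟩ := exists_ne i
  have hred : IsReduced ((j, true) :: w.toWord) := by
    rw [hL, isReduced_cons_cons, ← hL]
    exact ⟨fun e => absurd e hj, isReduced_toWord⟩
  have h₁ : reduce (w.toWord ++ [(j, true)]) = (j, true) :: w.toWord := by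
    have := congrArg toWord (h j)
    rw [toWord_mul, toWord_mul, toWord_of, List.singleton_append, hred.reduce_eq] at this
    exact this
  have h₂ : Red (w.toWord ++ [(j, true)]) ((j, true) :: w.toWord) := h₁ ▸ reduce.red
  have h₃ := h₂.sublist.eq_of_length (by simp)
  rw [hL] at h₃
  simp at h₃
  exact hj h₃.1.1

end FreeGroup

/-! ### Configuration counting and output length of logspace transducers -/

namespace Logspace

variable {A B : Type}

/-- The configuration after a number of steps, if the machine has not halted before. -/
def run (M : Transducer A B) (w : List A) : ℕ → Option (Config M)
  | 0 => some (init M)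
  | n + 1 => (run M w n).bind (step M w)

theorem reaches_of_run {M : Transducer A B} {w : List A} {n : ℕ} {c : Config M}
    (h : run M w n = some c) : StateTransition.Reaches (step M w) (init M) c := by
  induction n generalizing c with
  | zero => cases h; exact .refl
  | succ n ih =>
    obtain ⟨d, hd, hc⟩ := Option.bind_eq_some_iff.1 h
    exact (ih hd).tail hc

theorem exists_run_of_reaches {M : Transducer A B} {w : List A} {c : Config M}
    (h : StateTransition.Reaches (step M w) (init M) c) : ∃ n, run M w n = some c := by
  induction h with
  | refl => exact ⟨0, rfl⟩
  | tail _ h ih =>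
    obtain ⟨n, hn⟩ := ih
    exact ⟨n + 1, by rw [run, hn]; exact h⟩

/-- A configuration without the output tape. -/
def Config.core {M : Transducer A B} (c : Config M) : M.State × ℕ × (ℕ → M.Work) × ℕ :=
  (c.state, c.inputPos, c.tape, c.workPos)

/-- The output tape is never read, so it does not influence the rest of the run. -/
theorem map_core_step {M : Transducer A B} {w : List A} {c d : Config M} (h : c.core = d.core) :
    (step M w c).map Config.core = (step M w d).map Config.core := by
  obtain ⟨q, i, t, k, o⟩ := c
  obtain ⟨q', i', t', k', o'⟩ := d
  simp only [Config.core, Prod.mk.injEq] at h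
  obtain ⟨rfl, rfl, rfl, rfl⟩ := h
  simp only [step, Option.map_map]
  rfl

theorem map_core_run_add {M : Transducer A B} {w : List A} {i j : ℕ}
    (h : (run M w i).map Config.core = (run M w j).map Config.core) (k : ℕ) :
    (run M w (i + k)).map Config.core = (run M w (j + k)).map Config.core := by
  induction k with
  | zero => exact h
  | succ k ih =>
    rw [← add_assoc, ← add_assoc, run, run]
    revert ih
    cases run M w (i + k) <;> cases run M w (j + k) <;> intro ih
    · rfl
    · simp at ih
    · simp at ih
    · exact map_core_step (by simpa using ih)

theorem run_add_eq_none {M : Transducer A B} {w : List A} {n : ℕ} (h : run M w n = none) (k : ℕ) :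
    run M w (n + k) = none := by
  induction k with
  | zero => exact h
  | succ k ih => rw [← add_assoc, run, ih]; rfl

/-- A halting machine never repeats a configuration, even up to the output. -/
theorem core_ne {M : Transducer A B} {w : List A} {n : ℕ} {f : ℕ → Config M}
    (hf : ∀ i ≤ n, run M w i = some (f i)) (hhalt : step M w (f n) = none) {i j : ℕ}
    (hij : i < j) (hj : j ≤ n) : (f i).core ≠ (f j).core := by
  intro h
  -- Run both for `n - j + 1` more steps: from time `j` the machine has stopped, but from time `i`
  -- it is only at a time `≤ n`.
  have h₁ := map_core_run_add (M := M) (w := w) (i := i) (j := j)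
    (by rw [hf i (by omega), hf j hj]; simp [h]) (n - j + 1)
  have h₂ : run M w (j + (n - j + 1)) = none := by
    rw [show j + (n - j + 1) = n + 1 by omega, run, hf n le_rfl]
    exact hhalt
  rw [h₂, hf (i + (n - j + 1)) (by omega)] at h₁
  simp at h₁

theorem exists_run_of_le {M : Transducer A B} {w : List A} {n : ℕ} {c : Config M}
    (h : run M w n = some c) {i : ℕ} (hi : i ≤ n) : ∃ d, run M w i = some d := by
  rw [← Option.ne_none_iff_exists']
  intro h'
  have := run_add_eq_none h' (n - i)
  rw [Nat.add_sub_cancel' hi, h] at this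
  cases this

theorem inputPos_le_and_tape {M : Transducer A B} {w : List A} {s n : ℕ} (hs : UsesSpace M w s)
    {c : Config M} (h : run M w n = some c) :
    c.inputPos ≤ w.length + 1 ∧ ∀ i, s ≤ i → c.tape i = M.blank := by
  induction n generalizing c with
  | zero => cases h; exact ⟨Nat.zero_le _, fun _ _ => rfl⟩
  | succ n ih =>
    obtain ⟨d, hd, hc⟩ := Option.bind_eq_some_iff.1 h
    obtain ⟨hpos, htape⟩ := ih hd
    have hwork := hs d (reaches_of_run hd)
    obtain ⟨⟨q, x, mi, mw, out⟩, -, rfl⟩ := Option.map_eq_some_iff.1 hc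
    constructor
    · cases mi <;> simp only [moveInput] <;> omega
    · intro i hi
      simp only
      rw [Function.update_of_ne (by omega), htape i hi]

/-- A machine that halts within `s` work cells makes fewer steps than it has configurations. -/
theorem steps_le {M : Transducer A B} {w : List A} {s n : ℕ} (hs : UsesSpace M w s)
    {c : Config M} (h : run M w n = some c) (hhalt : step M w c = none) :
    n + 1 ≤ Nat.card M.State * (w.length + 2) * Nat.card M.Work ^ s * s := by
  have := M.finite_state
  have := M.finite_work
  have : Nonempty (Config M) := ⟨c⟩
  choose! f hf using fun i (hi : i ≤ n) => exists_run_of_le h hi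
  have hfn : f n = c := Option.some.inj ((hf n le_rfl).symm.trans h)
  have hinj : ∀ i j, i < j → j ≤ n → (f i).core ≠ (f j).core := fun i j =>
    core_ne hf (by rwa [hfn])
  -- Finitely many data determine the core: the tape is blank from cell `s` on, and both heads have
  -- bounded position.
  let g : Fin (n + 1) → M.State × Fin (w.length + 2) × (Fin s → M.Work) × Fin s := fun i =>
    have hi := hf i (Nat.lt_succ_iff.1 i.2)
    ((f i).state, ⟨(f i).inputPos, Nat.lt_succ_iff.2 (inputPos_le_and_tape hs hi).1⟩,
      fun k => (f i).tape k, ⟨(f i).workPos, hs _ (reaches_of_run hi)⟩)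
  have hg : g.Injective := by
    have key : ∀ i j : Fin (n + 1), i < j → g i ≠ g j := fun i j hij hgij => by
      have hi := hf i (Nat.lt_succ_iff.1 i.2)
      have hj := hf j (Nat.lt_succ_iff.1 j.2)
      refine hinj i j hij (Nat.lt_succ_iff.1 j.2) ?_
      simp only [g, Prod.mk.injEq, Fin.mk.injEq] at hgij
      obtain ⟨h₁, h₂, h₃, h₄⟩ := hgij
      refine Prod.ext h₁ (Prod.ext h₂ (Prod.ext (funext fun k => ?_) h₄))
      by_cases hk : k < s
      · exact congrFun h₃ ⟨k, hk⟩
      · exact ((inputPos_le_and_tape hs hi).2 k (not_lt.1 hk)).trans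
          ((inputPos_le_and_tape hs hj).2 k (not_lt.1 hk)).symm
    intro i j hij
    by_contra hne
    rcases lt_or_gt_of_ne hne with h | h
    exacts [key i j h hij, key j i h hij.symm]
  have := Nat.card_le_card_of_injective g hg
  simpa [Nat.card_prod, Nat.card_fun, mul_assoc] using this

instance [Finite A] : Finite (InputSymbol A) :=
  Finite.of_injective (β := Option (Option A))
    (fun | .leftEnd => none | .rightEnd => some none | .letter x => some (some x))
    (by rintro (_ | _ | _) (_ | _ | _) h <;> simp_all)

theorem exists_output_le [Finite A] (M : Transducer A B) : ∃ K : ℕ, ∀ (w : List A) (n : ℕ)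
    (c : Config M), run M w n = some c → c.output.length ≤ n * K := by
  have := M.finite_state
  have := M.finite_work
  -- The longest word printed in one transition; a halting entry of the finite table counts as `0`.
  obtain ⟨K, hK⟩ := (Set.finite_range fun y : M.State × InputSymbol A × M.Work =>
    ((M.trans y.1 y.2.1 y.2.2).elim 0 fun z => z.2.2.2.2.length)).bddAbove
  refine ⟨K, fun w n c h => ?_⟩
  induction n generalizing c with
  | zero => cases h; simp [init]
  | succ n ih =>
    obtain ⟨d, hd, hc⟩ := Option.bind_eq_some_iff.1 h
    obtain ⟨⟨q, x, mi, mw, out⟩, ht, rfl⟩ := Option.map_eq_some_iff.1 hc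
    have h₁ := hK ⟨(d.state, readInput w d.inputPos, d.tape d.workPos), rfl⟩
    simp only [ht, Option.elim_some] at h₁
    rw [List.length_append, add_mul, one_mul]
    exact add_le_add (ih d hd) h₁

/-- The output of a logspace computable function has polynomially bounded length. -/
theorem LogspaceComputable.exists_length_le [Finite A] {f : List A → List B}
    (hf : LogspaceComputable f) :
    ∃ D E : ℕ, ∀ w, (f w).length ≤ D * (w.length + 1) ^ E := by
  obtain ⟨M, c, hM⟩ := hf
  obtain ⟨K, hK⟩ := exists_output_le M
  set Q := Nat.card M.State
  set g := Nat.card M.Work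
  -- The tape contents contribute exponent `g * c`; the two head positions contribute `1` each.
  refine ⟨Q * 2 * 2 ^ (g * c) * c * K, g * c + 2, fun w => ?_⟩
  obtain ⟨⟨d, hd, hhalt, hout⟩, hs⟩ := hM w
  obtain ⟨n, hn⟩ := exists_run_of_reaches hd
  have h₁ := steps_le hs hn hhalt
  have h₂ := hK w n d hn
  set N := w.length
  have hlog : 2 ^ Nat.log 2 N ≤ N + 1 := by
    rcases Nat.eq_zero_or_pos N with h | h
    · simp [h]
    · exact (Nat.pow_log_le_self 2 h.ne').trans (Nat.le_succ N)
  have hlog' : Nat.log 2 N + 1 ≤ N + 1 := Nat.succ_le_succ (Nat.log_le_self 2 N)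
  have hpow : g ^ (c * (Nat.log 2 N + 1)) ≤ 2 ^ (g * c) * (N + 1) ^ (g * c) := by
    calc g ^ (c * (Nat.log 2 N + 1)) ≤ (2 ^ g) ^ (c * (Nat.log 2 N + 1)) :=
          Nat.pow_le_pow_left Nat.lt_two_pow_self.le _
      _ = 2 ^ (g * c) * (2 ^ Nat.log 2 N) ^ (g * c) := by
          rw [← pow_mul, ← pow_mul, ← pow_add]; ring_nf
      _ ≤ _ := by gcongr
  rw [← hout]
  calc d.output.length ≤ n * K := h₂
    _ ≤ (Q * (N + 2) * g ^ (c * (Nat.log 2 N + 1)) * (c * (Nat.log 2 N + 1))) * K :=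
        Nat.mul_le_mul_right K ((Nat.le_succ n).trans h₁)
    _ ≤ (Q * (2 * (N + 1)) * (2 ^ (g * c) * (N + 1) ^ (g * c)) * (c * (N + 1))) * K := by
        gcongr; omega
    _ = _ := by ring

/-- A logspace computable function cannot have outputs of exponential length on inputs of linear
length. -/
theorem not_logspaceComputable_of_two_pow_le [Finite A] {f : List A → List B} {w : ℕ → List A}
    {C : ℕ} (hw : ∀ m, (w m).length ≤ C * (m + 1)) (hf : ∀ m, 2 ^ m ≤ (f (w m)).length) :
    ¬ LogspaceComputable f := by
  intro h
  obtain ⟨D, E, hDE⟩ := h.exists_length_le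
  have hbound : ∀ m : ℕ, 2 ^ m ≤ D * (C + 1) ^ E * (m + 1) ^ E := fun m =>
    calc 2 ^ m ≤ D * ((w m).length + 1) ^ E := (hf m).trans (hDE _)
      _ ≤ D * ((C + 1) * (m + 1)) ^ E := by
          gcongr
          linarith [hw m]
      _ = _ := by rw [mul_pow, mul_assoc]
  -- Exponential growth beats the polynomial bound. The factor `2` in the threshold below absorbs
  -- the shift from `2 ^ m` to `2 ^ (m + 1)`.
  have hlim := tendsto_pow_const_div_const_pow_of_one_lt E (one_lt_two (α := ℝ))
  have hev := (hlim.comp (Filter.tendsto_add_atTop_nat 1)).eventually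
    (gt_mem_nhds (show (0 : ℝ) < (2 * (D * (C + 1) ^ E + 1 : ℝ))⁻¹ by positivity))
  obtain ⟨m, hm⟩ := hev.exists
  have hb : (2 : ℝ) ^ m ≤ D * (C + 1) ^ E * (m + 1) ^ E := by exact_mod_cast hbound m
  simp only [Function.comp_apply] at hm
  rw [div_lt_iff₀ (by positivity), inv_mul_eq_div, lt_div_iff₀ (by positivity)] at hm
  push_cast at hm
  rw [pow_succ] at hm
  have : (0 : ℝ) < ((m : ℝ) + 1) ^ E := by positivity
  nlinarith

end Logspace

namespace Braid4

/-! ### Consequences of Artin's relations -/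

section GroupIdentities

variable {G : Type*} [Group G] {x y z : G}

/-- This says `σ₃ a = a σ₁`. With `b = σ₃ σ₁⁻¹` it gives both `σ₃ a σ₃⁻¹ = a b⁻¹` and `σ₁ a σ₁⁻¹ =
b⁻¹ a`. -/
theorem conj_a_eq (h₁ : x * y * x = y * x * y) (h₂ : y * z * y = z * y * z) (h₃ : x * z = z * x) :
    z * (x * y * x⁻¹ * z * y⁻¹ * x⁻¹) = x * y * x⁻¹ * z * y⁻¹ * x⁻¹ * x := by
  have h₄ : x⁻¹ * z = z * x⁻¹ := by rw [inv_mul_eq_iff_eq_mul, ← mul_assoc, h₃]; group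
  have h₅ : x⁻¹ * y⁻¹ * x⁻¹ = y⁻¹ * x⁻¹ * y⁻¹ := by
    simpa [mul_assoc] using congrArg (·⁻¹) h₁
  calc z * (x * y * x⁻¹ * z * y⁻¹ * x⁻¹) = (z * x) * y * (x⁻¹ * z) * y⁻¹ * x⁻¹ := by group
    _ = x * (z * y * z) * (x⁻¹ * y⁻¹ * x⁻¹) := by rw [← h₃, h₄]; group
    _ = x * y * (z * x⁻¹) * y⁻¹ := by rw [← h₂, h₅]; group
    _ = _ := by rw [← h₄]; group

theorem commute_a (h₁ : x * y * x = y * x * y) (h₃ : x * z = z * x) :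
    y * (x * y * x⁻¹ * z * y⁻¹ * x⁻¹) = x * y * x⁻¹ * z * y⁻¹ * x⁻¹ * y := by
  have h₅ : y⁻¹ * x⁻¹ * y = x * y⁻¹ * x⁻¹ := by
    rw [eq_mul_inv_iff_mul_eq, eq_mul_inv_iff_mul_eq, mul_assoc, mul_assoc, ← mul_assoc y, ← h₁]
    group
  calc y * (x * y * x⁻¹ * z * y⁻¹ * x⁻¹) = (y * x * y) * x⁻¹ * z * y⁻¹ * x⁻¹ := by group
    _ = x * y * x⁻¹ * (x * z) * y⁻¹ * x⁻¹ := by rw [← h₁]; group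
    _ = x * y * x⁻¹ * z * (y⁻¹ * x⁻¹ * y) := by rw [h₅, h₃]; group
    _ = _ := by group

theorem conj_b_eq (h₁ : x * y * x = y * x * y) (h₂ : y * z * y = z * y * z) (h₃ : x * z = z * x) :
    y * (z * x⁻¹) = z * x⁻¹ * (x * y * x⁻¹ * z * y⁻¹ * x⁻¹) * y := by
  have h₄ : x⁻¹ * z = z * x⁻¹ := by rw [inv_mul_eq_iff_eq_mul, ← mul_assoc, h₃]; group
  have h₅ : y⁻¹ * x⁻¹ * y⁻¹ = x⁻¹ * y⁻¹ * x⁻¹ := by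
    simpa [mul_assoc] using congrArg (·⁻¹) h₁.symm
  symm
  calc z * x⁻¹ * (x * y * x⁻¹ * z * y⁻¹ * x⁻¹) * y = z * y * (x⁻¹ * z) * y⁻¹ * x⁻¹ * y := by group
    _ = (z * y * z) * (x⁻¹ * y⁻¹ * x⁻¹) * y := by rw [h₄]; group
    _ = y * (z * x⁻¹) := by rw [← h₂, ← h₅]; group

theorem conj_t₁_eq (h₁ : x * y * x = y * x * y) :
    x * (x * y * x⁻¹ * x⁻¹) = x * y⁻¹ * (x * y * x⁻¹ * x⁻¹) * x := by
  have h₅ : x * y * x⁻¹ = y⁻¹ * x * y := by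
    rw [mul_inv_eq_iff_eq_mul, mul_assoc, mul_assoc, eq_inv_mul_iff_mul_eq, ← mul_assoc, ← h₁]
    group
  calc x * (x * y * x⁻¹ * x⁻¹) = x * (x * y * x⁻¹) * x⁻¹ := by group
    _ = x * (y⁻¹ * x * y) * x⁻¹ := by rw [h₅]
    _ = _ := by group

end GroupIdentities

/-! ### Exponent sum and the two actions on free groups -/

theorem braid_rel₁ : σ₁ * σ₂ * σ₁ = σ₂ * σ₁ * σ₂ := by
  have := PresentedGroup.one_of_mem (rels := artinRels)
    (x := FreeGroup.of 0 * FreeGroup.of 1 * FreeGroup.of 0 *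
      (FreeGroup.of 1 * FreeGroup.of 0 * FreeGroup.of 1)⁻¹) (by simp [artinRels])
  exact mul_inv_eq_one.1 this

theorem braid_rel₂ : σ₂ * σ₃ * σ₂ = σ₃ * σ₂ * σ₃ := by
  have := PresentedGroup.one_of_mem (rels := artinRels)
    (x := FreeGroup.of 1 * FreeGroup.of 2 * FreeGroup.of 1 *
      (FreeGroup.of 2 * FreeGroup.of 1 * FreeGroup.of 2)⁻¹) (by simp [artinRels])
  exact mul_inv_eq_one.1 this

theorem braid_rel₃ : σ₁ * σ₃ = σ₃ * σ₁ := by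
  have := PresentedGroup.one_of_mem (rels := artinRels)
    (x := FreeGroup.of 0 * FreeGroup.of 2 *
      (FreeGroup.of 2 * FreeGroup.of 0)⁻¹) (by simp [artinRels])
  exact mul_inv_eq_one.1 this

/-- A homomorphism out of `B4`, from three elements that satisfy Artin's relations. -/
def ofArtin {G : Type*} [Group G] (x y z : G) (h₁ : x * y * x = y * x * y)
    (h₂ : y * z * y = z * y * z) (h₃ : x * z = z * x) : B4 →* G :=
  PresentedGroup.toGroup (f := ![x, y, z]) (by
    rintro r (rfl | rfl | rfl)
    · simp [h₁]
    · simp [h₂]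
    · simp [h₃])

section ofArtin

variable {G : Type*} [Group G] {x y z : G} {h₁ : x * y * x = y * x * y}
  {h₂ : y * z * y = z * y * z} {h₃ : x * z = z * x}

@[simp] theorem ofArtin_σ₁ : ofArtin x y z h₁ h₂ h₃ σ₁ = x := PresentedGroup.toGroup.of _
@[simp] theorem ofArtin_σ₂ : ofArtin x y z h₁ h₂ h₃ σ₂ = y := PresentedGroup.toGroup.of _
@[simp] theorem ofArtin_σ₃ : ofArtin x y z h₁ h₂ h₃ σ₃ = z := PresentedGroup.toGroup.of _

end ofArtin

/-- The exponent sum of a braid. -/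
def exponentSum : B4 →* Multiplicative ℤ :=
  ofArtin (.ofAdd 1) (.ofAdd 1) (.ofAdd 1) rfl rfl rfl

/-- The free group of rank two. -/
abbrev F₂ : Type := FreeGroup (Fin 2)

/-- The endomorphism of the free group of rank two with given values on the generators. -/
def endo (u v : F₂) : F₂ →* F₂ := FreeGroup.lift ![u, v]

@[simp] theorem endo_of_zero (u v : F₂) : endo u v (.of 0) = u := by simp [endo]
@[simp] theorem endo_of_one (u v : F₂) : endo u v (.of 1) = v := by simp [endo]

theorem endo_hom_ext {f g : F₂ →* F₂} (h₀ : f (.of 0) = g (.of 0)) (h₁ : f (.of 1) = g (.of 1)) :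
    f = g := by
  refine FreeGroup.ext_hom _ _ fun i => ?_
  fin_cases i
  · exact h₀
  · exact h₁

/-- The automorphism of the free group of rank two given by the images of the generators under it
and under its inverse. -/
def auto (u v u' v' : F₂) (h : (endo u' v').comp (endo u v) = .id F₂)
    (h' : (endo u v).comp (endo u' v') = .id F₂) : MulAut F₂ :=
  MonoidHom.toMulEquiv (endo u v) (endo u' v') h h'

theorem mulAut_ext {f g : MulAut F₂} (h₀ : f (.of 0) = g (.of 0)) (h₁ : f (.of 1) = g (.of 1)) :
    f = g :=
  MulEquiv.toMonoidHom_injective (endo_hom_ext h₀ h₁)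

section auto
variable {u v u' v' : F₂} {h : (endo u' v').comp (endo u v) = .id F₂}
  {h' : (endo u v).comp (endo u' v') = .id F₂}

@[simp] theorem auto_of_zero : auto u v u' v' h h' (.of 0) = u := endo_of_zero u v
@[simp] theorem auto_of_one : auto u v u' v' h h' (.of 1) = v := endo_of_one u v
@[simp] theorem auto_symm_of_zero : (auto u v u' v' h h').symm (.of 0) = u' := endo_of_zero u' v'
@[simp] theorem auto_symm_of_one : (auto u v u' v' h h').symm (.of 1) = v' := endo_of_one u' v'

end auto

/-- `σ₁` acting by conjugation on the free group on `a`, `b`. -/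
def fiberσ₁ : MulAut F₂ :=
  auto ((.of 1)⁻¹ * .of 0) (.of 1) (.of 1 * .of 0) (.of 1)
    (endo_hom_ext (by simp) (by simp)) (endo_hom_ext (by simp) (by simp))

/-- `σ₂` acting by conjugation on the free group on `a`, `b`. -/
def fiberσ₂ : MulAut F₂ :=
  auto (.of 0) (.of 1 * .of 0) (.of 0) (.of 1 * (.of 0)⁻¹)
    (endo_hom_ext (by simp) (by simp)) (endo_hom_ext (by simp) (by simp))

/-- `σ₃` acting by conjugation on the free group on `a`, `b`. -/
def fiberσ₃ : MulAut F₂ :=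
  auto (.of 0 * (.of 1)⁻¹) (.of 1) (.of 0 * .of 1) (.of 1)
    (endo_hom_ext (by simp) (by simp)) (endo_hom_ext (by simp) (by simp))

/-- The conjugation action of `B4` on its normal subgroup freely generated by `a`, `b`. -/
def fiberAction : B4 →* MulAut F₂ :=
  ofArtin fiberσ₁ fiberσ₂ fiberσ₃
    (mulAut_ext (by simp [fiberσ₁, fiberσ₂, mul_assoc]) (by simp [fiberσ₁, fiberσ₂, mul_assoc]))
    (mulAut_ext (by simp [fiberσ₃, fiberσ₂, mul_assoc]) (by simp [fiberσ₃, fiberσ₂, mul_assoc]))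
    (mulAut_ext (by simp [fiberσ₁, fiberσ₃, mul_assoc]) (by simp [fiberσ₁, fiberσ₃]))

/-- `σ₁` acting by conjugation on the free group on `t₁`, `t₂`. -/
def baseσ₁ : MulAut F₂ :=
  auto ((.of 1)⁻¹ * .of 0) (.of 0) (.of 1) (.of 1 * (.of 0)⁻¹)
    (endo_hom_ext (by simp) (by simp)) (endo_hom_ext (by simp) (by simp))

/-- The action of `B4`, through the quotient `B₃` in which `b` becomes trivial, on the normal
subgroup of `B₃` freely generated by `t₁`, `t₂`. -/
def baseAction : B4 →* MulAut F₂ :=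
  ofArtin baseσ₁ (MulAut.conj (.of 1) * baseσ₁) baseσ₁
    (mulAut_ext (by simp [baseσ₁, mul_assoc]) (by simp [baseσ₁, mul_assoc]))
    (mulAut_ext (by simp [baseσ₁, mul_assoc]) (by simp [baseσ₁, mul_assoc]))
    rfl

/-- The free group on `a`, `b`, mapped to `B4`. -/
def fiberIncl : F₂ →* B4 := FreeGroup.lift ![GorinLin.a.braid, GorinLin.b.braid]

/-- The free group on `t₁`, `t₂`, mapped to `B4`. -/
def baseIncl : F₂ →* B4 := FreeGroup.lift ![GorinLin.t₁.braid, GorinLin.t₂.braid]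

/-- Since `F₂` has trivial centre, this makes `fiberIncl` injective: `a` and `b` generate a free
group. `baseAction_baseIncl` does the same for `t₁`, `t₂`. -/
theorem fiberAction_fiberIncl (x : F₂) : fiberAction (fiberIncl x) = MulAut.conj x := by
  refine DFunLike.congr_fun (f := fiberAction.comp fiberIncl) (g := MulAut.conj)
    (FreeGroup.ext_hom _ _ fun i => ?_) x
  fin_cases i <;>
  exact mulAut_ext
    (by simp [fiberIncl, fiberAction, GorinLin.braid, fiberσ₁, fiberσ₂, fiberσ₃, mul_assoc])
    (by simp [fiberIncl, fiberAction, GorinLin.braid, fiberσ₁, fiberσ₂, fiberσ₃, mul_assoc])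

theorem baseAction_fiberIncl (x : F₂) : baseAction (fiberIncl x) = 1 := by
  refine DFunLike.congr_fun (f := baseAction.comp fiberIncl) (g := 1)
    (FreeGroup.ext_hom _ _ fun i => ?_) x
  fin_cases i <;> simp [fiberIncl, baseAction, GorinLin.braid, mul_assoc]

theorem baseAction_baseIncl (x : F₂) : baseAction (baseIncl x) = MulAut.conj x := by
  refine DFunLike.congr_fun (f := baseAction.comp baseIncl) (g := MulAut.conj)
    (FreeGroup.ext_hom _ _ fun i => ?_) x
  fin_cases i <;>
  exact mulAut_ext
    (by simp [baseIncl, baseAction, GorinLin.braid, baseσ₁, mul_assoc])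
    (by simp [baseIncl, baseAction, GorinLin.braid, baseσ₁, mul_assoc])

theorem exponentSum_fiberIncl (x : F₂) : exponentSum (fiberIncl x) = 1 := by
  refine DFunLike.congr_fun (f := exponentSum.comp fiberIncl) (g := 1)
    (FreeGroup.ext_hom _ _ fun i => ?_) x
  fin_cases i <;> simp [fiberIncl, exponentSum, GorinLin.braid]

theorem exponentSum_baseIncl (x : F₂) : exponentSum (baseIncl x) = 1 := by
  refine DFunLike.congr_fun (f := exponentSum.comp baseIncl) (g := 1)
    (FreeGroup.ext_hom _ _ fun i => ?_) x
  fin_cases i <;> simp [baseIncl, exponentSum, GorinLin.braid]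

@[elab_as_elim]
theorem B4.induction {p : B4 → Prop} (one : p 1) (mul : ∀ x y, p x → p y → p (x * y))
    (inv : ∀ x, p x → p x⁻¹) (h₁ : p σ₁) (h₂ : p σ₂) (h₃ : p σ₃) (β : B4) : p β := by
  induction β using PresentedGroup.induction_on with
  | _ z =>
    induction z using FreeGroup.induction_on with
    | C1 => simpa using one
    | of i => fin_cases i <;> assumption
    | inv_of i h => simpa using inv _ h
    | mul x y hx hy => simpa using mul _ _ hx hy

/-- The abstract action is actual conjugation, hence `⟨a, b⟩` is normal. Both sides are
multiplicative in the braid and in `x`, so only Artin generators acting on `a` and `b` need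
checking. -/
theorem conj_fiberIncl (β : B4) (x : F₂) : β * fiberIncl x * β⁻¹ = fiberIncl (fiberAction β x) := by
  have key : ∀ γ : B4, (∀ i, γ * fiberIncl (.of i) * γ⁻¹ = fiberIncl (fiberAction γ (.of i))) →
      ∀ x, γ * fiberIncl x * γ⁻¹ = fiberIncl (fiberAction γ x) := fun γ h x =>
    DFunLike.congr_fun (f := (MulAut.conj γ).toMonoidHom.comp fiberIncl)
      (g := fiberIncl.comp (fiberAction γ).toMonoidHom) (FreeGroup.ext_hom _ _ h) x
  induction β using B4.induction generalizing x with
  | one => simp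
  | mul γ δ hγ hδ => rw [map_mul, MulAut.mul_apply, ← hγ, ← hδ]; group
  | inv γ hγ =>
    have := hγ (fiberAction γ⁻¹ x)
    rw [map_inv, MulAut.apply_inv_self] at this
    rw [← this, map_inv]; group
  | h₁ =>
    refine key _ (fun i => ?_) x
    rw [mul_inv_eq_iff_eq_mul]
    fin_cases i
    · have := conj_a_eq braid_rel₁ braid_rel₂ braid_rel₃
      simpa [fiberIncl, fiberAction, GorinLin.braid, fiberσ₁, mul_assoc, eq_inv_mul_iff_mul_eq]
        using this
    · simp [fiberIncl, fiberAction, GorinLin.braid, fiberσ₁, braid_rel₃, ← mul_assoc]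
  | h₂ =>
    refine key _ (fun i => ?_) x
    rw [mul_inv_eq_iff_eq_mul]
    fin_cases i
    · simpa [fiberIncl, fiberAction, GorinLin.braid, fiberσ₂] using
        commute_a braid_rel₁ braid_rel₃
    · simpa [fiberIncl, fiberAction, GorinLin.braid, fiberσ₂] using
        conj_b_eq braid_rel₁ braid_rel₂ braid_rel₃
  | h₃ =>
    refine key _ (fun i => ?_) x
    rw [mul_inv_eq_iff_eq_mul]
    fin_cases i
    · have := conj_a_eq braid_rel₁ braid_rel₂ braid_rel₃
      simpa [fiberIncl, fiberAction, GorinLin.braid, fiberσ₃, mul_assoc] using this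
    · simp [fiberIncl, fiberAction, GorinLin.braid, fiberσ₃, mul_assoc, eq_inv_mul_iff_mul_eq]
      rw [← mul_assoc, braid_rel₃, mul_inv_cancel_right]

/-- Only `σ₁` is needed here: `⟨t₁, t₂⟩` is normal in `⟨t₁, t₂, t⟩` but not in `B4`. -/
theorem conj_baseIncl (x : F₂) : σ₁ * baseIncl x * σ₁⁻¹ = baseIncl (baseAction σ₁ x) := by
  refine DFunLike.congr_fun (f := (MulAut.conj σ₁).toMonoidHom.comp baseIncl)
      (g := baseIncl.comp (baseAction σ₁).toMonoidHom) (FreeGroup.ext_hom _ _ fun i => ?_) x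
  rw [MonoidHom.comp_apply, MulEquiv.coe_toMonoidHom, MulAut.conj_apply, mul_inv_eq_iff_eq_mul]
  fin_cases i
  · simpa [baseIncl, baseAction, GorinLin.braid, baseσ₁] using conj_t₁_eq braid_rel₁
  · simp [baseIncl, baseAction, GorinLin.braid, baseσ₁, mul_assoc]

/-! ### Normal forms as triples of an integer and two free group elements -/

/-- The reduced word of an element of the free group of rank two, spelt in two of the Gorin–Lin
letters. -/
def spell (e : Fin 2 → GorinLin) (x : F₂) : List Letter := x.toWord.map (Prod.map e id)

theorem exists_spell_iff {e : Fin 2 → GorinLin} (he : e.Injective) (V : List Letter) :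
    ((∀ x ∈ V, x.1 = e 0 ∨ x.1 = e 1) ∧ FreeGroup.IsReduced V) ↔ ∃ v : F₂, V = spell e v := by
  have key : ∀ L : List (Fin 2 × Bool),
      FreeGroup.IsReduced (L.map (Prod.map e id)) ↔ FreeGroup.IsReduced L := fun L => by
    simp [FreeGroup.IsReduced, List.isChain_map, he.eq_iff]
  constructor
  · rintro ⟨hV, hred⟩
    obtain ⟨L, rfl⟩ : ∃ L : List (Fin 2 × Bool), V = L.map (Prod.map e id) := by
      have : V ∈ Set.range (List.map (Prod.map e id)) := by
        rw [Set.range_list_map]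
        intro x hx
        rcases hV x hx with h | h
        · exact ⟨(0, x.2), Prod.ext h.symm rfl⟩
        · exact ⟨(1, x.2), Prod.ext h.symm rfl⟩
      obtain ⟨L, hL⟩ := this
      exact ⟨L, hL.symm⟩
    exact ⟨.mk L, by rw [spell, FreeGroup.toWord_mk, ((key L).1 hred).reduce_eq]⟩
  · rintro ⟨v, rfl⟩
    refine ⟨fun x hx => ?_, (key _).2 FreeGroup.isReduced_toWord⟩
    obtain ⟨⟨i, s⟩, -, rfl⟩ := List.mem_map.1 hx
    fin_cases i
    · exact .inl rfl
    · exact .inr rfl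

theorem evalWord_append {A G : Type} [Group G] (g : A → G) (u v : List A) :
    evalWord g (u ++ v) = evalWord g u * evalWord g v := by
  simp [evalWord]

theorem evalWord_spell (e : Fin 2 → GorinLin) (x : F₂) :
    evalWord letterBraid (spell e x) = FreeGroup.lift (fun i => (e i).braid) x := by
  conv_rhs => rw [← FreeGroup.mk_toWord (x := x), FreeGroup.lift_mk]
  rw [evalWord, spell, List.map_map]
  congr 2
  ext ⟨i, s⟩
  cases s <;> rfl

theorem evalWord_tPow (p : ℤ) : evalWord letterBraid (tPow p) = σ₁ ^ p := by
  rcases le_or_gt 0 p with hp | hp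
  · lift p to ℕ using hp
    simp [evalWord, tPow, letterBraid, GorinLin.braid]
  · obtain ⟨n, rfl⟩ := Int.exists_eq_neg_ofNat hp.le
    simp [evalWord, tPow, letterBraid, GorinLin.braid]
    intro h
    omega

theorem isHNNNormalForm_iff (u : List Letter) (β : B4) :
    IsHNNNormalForm u β ↔ ∃ (p : ℤ) (v w : F₂),
      u = tPow p ++ spell ![.t₁, .t₂] v ++ spell ![.a, .b] w ∧
        σ₁ ^ p * baseIncl v * fiberIncl w = β := by
  have h₁ := exists_spell_iff (e := ![.t₁, .t₂]) (by simp [Function.Injective, Fin.forall_fin_two])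
  have h₂ := exists_spell_iff (e := ![.a, .b]) (by simp [Function.Injective, Fin.forall_fin_two])
  have e₁ : ∀ v, evalWord letterBraid (spell ![.t₁, .t₂] v) = baseIncl v := fun v => by
    rw [evalWord_spell, baseIncl]
    congr 2
    ext i
    fin_cases i <;> rfl
  have e₂ : ∀ v, evalWord letterBraid (spell ![.a, .b] v) = fiberIncl v := fun v => by
    rw [evalWord_spell, fiberIncl]
    congr 2
    ext i
    fin_cases i <;> rfl
  constructor
  · rintro ⟨p, V, W, hV, hV', hW, hW', rfl, rfl⟩
    obtain ⟨v, rfl⟩ := (h₁ V).1 ⟨hV, hV'⟩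
    obtain ⟨w, rfl⟩ := (h₂ W).1 ⟨hW, hW'⟩
    exact ⟨p, v, w, rfl, by rw [evalWord_append, evalWord_append, evalWord_tPow, e₁, e₂]⟩
  · rintro ⟨p, v, w, rfl, rfl⟩
    obtain ⟨hV, hV'⟩ := (h₁ _).2 ⟨v, rfl⟩
    obtain ⟨hW, hW'⟩ := (h₂ _).2 ⟨w, rfl⟩
    exact ⟨p, _, _, hV, hV', hW, hW', rfl,
      by rw [evalWord_append, evalWord_append, evalWord_tPow, e₁, e₂]⟩

/-! ### Uniqueness and existence of the factorization -/

theorem conj_injective : Function.Injective (MulAut.conj : F₂ →* MulAut F₂) := by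
  rw [injective_iff_map_eq_one]
  intro x hx
  refine FreeGroup.eq_one_of_commute_of fun i => ?_
  have := DFunLike.congr_fun hx (.of i)
  rwa [MulAut.conj_apply, mul_inv_eq_iff_eq_mul] at this

/-- The three coordinates are read off in turn: the exponent sum kills both free factors,
`baseAction` kills `⟨a, b⟩`, and `fiberAction` separates the elements of `⟨a, b⟩`. -/
theorem factorization_injective {p p' : ℤ} {v v' w w' : F₂}
    (h : σ₁ ^ p * baseIncl v * fiberIncl w = σ₁ ^ p' * baseIncl v' * fiberIncl w') :
    p = p' ∧ v = v' ∧ w = w' := by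
  obtain rfl : p = p' := by
    have := congrArg exponentSum h
    simp only [map_mul, map_zpow, exponentSum_baseIncl, exponentSum_fiberIncl, mul_one] at this
    simpa [exponentSum, ← ofAdd_zsmul] using this
  rw [mul_assoc, mul_assoc, mul_left_cancel_iff] at h
  obtain rfl : v = v' := by
    have := congrArg baseAction h
    simp only [map_mul, baseAction_baseIncl, baseAction_fiberIncl, mul_one] at this
    exact conj_injective this
  rw [mul_left_cancel_iff] at h
  refine ⟨rfl, rfl, conj_injective ?_⟩
  rw [← fiberAction_fiberIncl, h, fiberAction_fiberIncl]

/-- A braid that can be written as `t^p v w`. -/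
def HasFactorization (β : B4) : Prop :=
  ∃ (p : ℤ) (v w : F₂), σ₁ ^ p * baseIncl v * fiberIncl w = β

theorem fiberIncl_mul (w : F₂) (β : B4) :
    fiberIncl w * β = β * fiberIncl (fiberAction β⁻¹ w) := by
  rw [← conj_fiberIncl]; group

theorem baseIncl_mul_zpow (v : F₂) (p : ℤ) :
    ∃ v', baseIncl v * σ₁ ^ p = σ₁ ^ p * baseIncl v' := by
  have h₁ : ∀ v, ∃ v', baseIncl v * σ₁ = σ₁ * baseIncl v' := fun v =>
    ⟨baseAction σ₁⁻¹ v, by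
      have := conj_baseIncl (baseAction σ₁⁻¹ v)
      rw [map_inv, MulAut.apply_inv_self] at this
      rw [← this, map_inv]; group⟩
  have h₂ : ∀ v, ∃ v', baseIncl v * σ₁⁻¹ = σ₁⁻¹ * baseIncl v' := fun v =>
    ⟨baseAction σ₁ v, by rw [← conj_baseIncl]; group⟩
  induction p generalizing v with
  | zero => exact ⟨v, by simp⟩
  | succ n ih =>
    obtain ⟨v', hv'⟩ := ih v
    obtain ⟨v'', hv''⟩ := h₁ v'
    exact ⟨v'', by rw [zpow_add_one, ← mul_assoc, hv', mul_assoc, hv'', mul_assoc]⟩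
  | pred n ih =>
    obtain ⟨v', hv'⟩ := ih v
    obtain ⟨v'', hv''⟩ := h₂ v'
    exact ⟨v'', by rw [zpow_sub_one, ← mul_assoc, hv', mul_assoc, hv'', mul_assoc]⟩

theorem HasFactorization.mul {β γ : B4} (hβ : HasFactorization β) (hγ : HasFactorization γ) :
    HasFactorization (β * γ) := by
  obtain ⟨p, v, w, rfl⟩ := hβ
  obtain ⟨p', v', w', rfl⟩ := hγ
  obtain ⟨v₁, hv₁⟩ := baseIncl_mul_zpow v p'
  -- Normality lets `w` move right past `t^p' v'`, and then `v` moves right past `t^p'`.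
  refine ⟨p + p', v₁ * v', fiberAction (σ₁ ^ p' * baseIncl v')⁻¹ w * w', ?_⟩
  calc _ = σ₁ ^ p * (σ₁ ^ p' * baseIncl v₁) * baseIncl v' *
        (fiberIncl (fiberAction (σ₁ ^ p' * baseIncl v')⁻¹ w) * fiberIncl w') := by
        simp only [zpow_add, map_mul, mul_assoc]
    _ = σ₁ ^ p * baseIncl v * ((σ₁ ^ p' * baseIncl v') *
        fiberIncl (fiberAction (σ₁ ^ p' * baseIncl v')⁻¹ w)) * fiberIncl w' := by
        rw [← hv₁]; simp only [mul_assoc]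
    _ = _ := by rw [← fiberIncl_mul]; simp only [mul_assoc]

theorem hasFactorization_zpow (p : ℤ) : HasFactorization (σ₁ ^ p) := ⟨p, 1, 1, by simp⟩

theorem hasFactorization_baseIncl (v : F₂) : HasFactorization (baseIncl v) := ⟨0, v, 1, by simp⟩

theorem hasFactorization_fiberIncl (w : F₂) : HasFactorization (fiberIncl w) := ⟨0, 1, w, by simp⟩

theorem hasFactorization (β : B4) : HasFactorization β := by
  induction β using B4.induction with
  | one => exact hasFactorization_zpow 0
  | mul x y hx hy => exact hx.mul hy
  | inv x hx =>
    obtain ⟨p, v, w, rfl⟩ := hx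
    have := ((hasFactorization_fiberIncl w⁻¹).mul (hasFactorization_baseIncl v⁻¹)).mul
      (hasFactorization_zpow (-p))
    simpa [mul_assoc] using this
  | h₁ => simpa using hasFactorization_zpow 1
  | h₂ =>
    have := (hasFactorization_baseIncl (.of 1)).mul (hasFactorization_zpow 1)
    simpa [baseIncl, GorinLin.braid] using this
  | h₃ =>
    have := (hasFactorization_fiberIncl (.of 1)).mul (hasFactorization_zpow 1)
    simpa [fiberIncl, GorinLin.braid] using this

theorem existsUnique_isHNNNormalForm (β : B4) : ∃! u : List Letter, IsHNNNormalForm u β := by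
  obtain ⟨p, v, w, h⟩ := hasFactorization β
  refine ⟨_, (isHNNNormalForm_iff _ β).2 ⟨p, v, w, rfl, h⟩, fun u hu => ?_⟩
  obtain ⟨p', v', w', rfl, h'⟩ := (isHNNNormalForm_iff u β).1 hu
  obtain ⟨rfl, rfl, rfl⟩ := factorization_injective (h'.trans h.symm)
  rfl

/-! ### Exponential length of the normal forms -/

/-- The braid `b^{t₁^m}`. -/
def conjBraid (m : ℕ) : B4 :=
  (GorinLin.t₁.braid ^ m)⁻¹ * GorinLin.b.braid * GorinLin.t₁.braid ^ m

theorem fiberAction_t₁_inv_of_one : fiberAction GorinLin.t₁.braid⁻¹ (.of 1) =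
    .of 1 * (.of 0)⁻¹ * .of 1 * .of 1 := by
  simp [fiberAction, GorinLin.braid, fiberσ₁, fiberσ₂, mul_assoc]

theorem fiberAction_t₁_inv_of_zero : fiberAction GorinLin.t₁.braid⁻¹ (.of 0) = .of 1 := by
  simp [fiberAction, GorinLin.braid, fiberσ₁, fiberσ₂, mul_assoc]

/-- A generator that occurs with one sign only cannot cancel. -/
theorem isReduced_of_forall_mem {α : Type*} {L : List (α × Bool)} {s : α → Bool}
    (h : ∀ x ∈ L, x.2 = s x.1) : FreeGroup.IsReduced L := by
  refine List.Pairwise.isChain (List.pairwise_of_forall_mem_list fun x hx y hy e => ?_)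
  rw [h x hx, h y hy, e]

/-- The images of `b` and of `b a⁻¹ b` under the `m`-th power of the conjugation by `t₁⁻¹` are
spelt by words in `a⁻¹` and `b`, whose lengths are consecutive Lucas numbers. -/
theorem exists_words_fiberAction_pow (m : ℕ) : ∃ L L' : List (Fin 2 × Bool),
    (∀ x ∈ L, x.2 = ![false, true] x.1) ∧ (∀ x ∈ L', x.2 = ![false, true] x.1) ∧
    FreeGroup.mk L = fiberAction (GorinLin.t₁.braid ^ m)⁻¹ (.of 1) ∧
    FreeGroup.mk L' = fiberAction (GorinLin.t₁.braid ^ m)⁻¹ (.of 1 * (.of 0)⁻¹ * .of 1) ∧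
    (L.length : ℝ) = Real.goldenRatio ^ (2 * m + 1) - (Real.goldenRatio ^ (2 * m + 1))⁻¹ ∧
    (L'.length : ℝ) = Real.goldenRatio ^ (2 * m + 2) + (Real.goldenRatio ^ (2 * m + 2))⁻¹ ∧
    2 ^ m ≤ L.length ∧ L.length ≤ L'.length := by
  have hinv : Real.goldenRatio⁻¹ = Real.goldenRatio - 1 := by
    rw [Real.inv_goldenRatio]; linarith [Real.goldenRatio_add_goldenConj]
  -- The recursion for powers of `Φ⁻¹`; the alternating signs in the length formulas come from
  -- `-Φ⁻¹` being the conjugate root.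
  have hsq : Real.goldenRatio⁻¹ ^ 2 = 1 - Real.goldenRatio⁻¹ := by
    rw [hinv]; linear_combination Real.goldenRatio_sq
  induction m with
  | zero =>
    refine ⟨[(1, true)], [(1, true), (0, false), (1, true)], by simp, by simp, by simp [FreeGroup.of],
      by simp [FreeGroup.of, FreeGroup.invRev], ?_, ?_, by simp, by simp⟩
    · simp [hinv]
    · simp only [← inv_pow]
      rw [mul_zero, zero_add, hsq, Real.goldenRatio_sq, hinv]
      norm_num [List.length]
      ring
  | succ m ih =>
    obtain ⟨L, L', hL, hL', h, h', hl, hl', h2, hle⟩ := ih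
    have hpow : (GorinLin.t₁.braid ^ (m + 1))⁻¹ =
        (GorinLin.t₁.braid ^ m)⁻¹ * GorinLin.t₁.braid⁻¹ := by rw [pow_succ', mul_inv_rev]
    -- Put `c = b a⁻¹ b`. Conjugation by `t₁⁻¹` sends `b` to `c b` and `c` to `(c b) b⁻¹ (c b) = c c
    -- b`, so the inverse letter disappears. Carrying `L.length ≤ L'.length` along gives the
    -- doubling of `L.length`.
    refine ⟨L' ++ L, L' ++ (L' ++ L), ?_, ?_, ?_, ?_, ?_, ?_, ?_, ?_⟩
    · simp only [List.mem_append]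
      rintro x (hx | hx)
      exacts [hL' x hx, hL x hx]
    · simp only [List.mem_append]
      rintro x (hx | hx | hx)
      exacts [hL' x hx, hL' x hx, hL x hx]
    · rw [← FreeGroup.mul_mk, h, h', hpow, map_mul fiberAction, MulAut.mul_apply,
        fiberAction_t₁_inv_of_one, ← map_mul]
    · rw [← FreeGroup.mul_mk, ← FreeGroup.mul_mk, h, h', hpow, map_mul fiberAction,
        MulAut.mul_apply, ← map_mul, ← map_mul]
      congr 1
      rw [map_mul (fiberAction _), map_mul (fiberAction _), map_inv (fiberAction _), fiberAction_t₁_inv_of_one, fiberAction_t₁_inv_of_zero]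
      group
    · rw [List.length_append, Nat.cast_add, hl, hl']
      simp only [← inv_pow]
      generalize Real.goldenRatio⁻¹ = y at hsq
      linear_combination (-Real.goldenRatio ^ (2 * m + 1)) * Real.goldenRatio_sq
        + y ^ (2 * m + 1) * hsq
    · rw [List.length_append, List.length_append, Nat.cast_add, Nat.cast_add, hl, hl']
      simp only [← inv_pow]
      generalize Real.goldenRatio⁻¹ = y at hsq
      linear_combination
        (-Real.goldenRatio ^ (2 * m + 2) - Real.goldenRatio ^ (2 * m + 1)) * Real.goldenRatio_sq
        + (y ^ (2 * m + 1) - y ^ (2 * m + 2)) * hsq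
    · rw [List.length_append, pow_succ]; omega
    · simp

theorem conjBraid_eq (m : ℕ) :
    conjBraid m = fiberIncl (fiberAction (GorinLin.t₁.braid ^ m)⁻¹ (.of 1)) := by
  rw [← conj_fiberIncl, inv_inv, conjBraid]
  simp [fiberIncl]

theorem length_of_isHNNNormalForm_conjBraid {m : ℕ} {u : List Letter}
    (hu : IsHNNNormalForm u (conjBraid m)) :
    (u.length : ℝ) = Real.goldenRatio ^ (2 * m + 1) - (Real.goldenRatio ^ (2 * m + 1))⁻¹ ∧
      2 ^ m ≤ u.length := by
  obtain ⟨L, -, hL, -, h, -, hl, -, h2, -⟩ := exists_words_fiberAction_pow m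
  -- The conjugate lies in `⟨a, b⟩`, so its normal form has `p = 0` and `V` empty.
  have hu' : IsHNNNormalForm (spell ![.a, .b] (.mk L)) (conjBraid m) :=
    (isHNNNormalForm_iff _ _).2 ⟨0, 1, .mk L, by simp [tPow, spell], by simp [conjBraid_eq, h]⟩
  obtain rfl := (existsUnique_isHNNNormalForm _).unique hu hu'
  rw [spell, List.length_map, FreeGroup.toWord_mk, (isReduced_of_forall_mem hL).reduce_eq]
  exact ⟨hl, h2⟩

/-! ### Failure of logspace computability -/

theorem exists_evalWord_eq {A G : Type} [Group G] {g : A → G}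
    (hg : Submonoid.closure (Set.range g) = ⊤) (β : G) : ∃ w : List A, evalWord g w = β := by
  obtain ⟨l, hl, rfl⟩ := Submonoid.exists_list_of_mem_closure
    (show β ∈ Submonoid.closure (Set.range g) by rw [hg]; trivial)
  obtain ⟨w, rfl⟩ : l ∈ Set.range (List.map g) := by rw [Set.range_list_map]; exact hl
  exact ⟨w, rfl⟩

/-- Every braid has a normal form, which is already a product of letters. -/
theorem closure_range_letterBraid : Submonoid.closure (Set.range letterBraid) = ⊤ := by
  refine (Submonoid.eq_top_iff' _).2 fun β => ?_
  obtain ⟨u, ⟨_, _, _, _, _, _, _, _, rfl⟩, -⟩ := existsUnique_isHNNNormalForm β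
  refine Submonoid.list_prod_mem _ fun x hx => ?_
  obtain ⟨y, -, rfl⟩ := List.mem_map.1 hx
  exact Submonoid.subset_closure ⟨y, rfl⟩

theorem not_logspaceComputable_hnnNormalForm {A : Type} [Finite A] {g : A → B4}
    (hg : Submonoid.closure (Set.range g) = ⊤) {f : List A → List Letter}
    (hf : ∀ w, IsHNNNormalForm (f w) (evalWord g w)) : ¬ Logspace.LogspaceComputable f := by
  obtain ⟨x, hx⟩ := exists_evalWord_eq hg GorinLin.t₁.braid⁻¹
  obtain ⟨y, hy⟩ := exists_evalWord_eq hg GorinLin.b.braid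
  obtain ⟨z, hz⟩ := exists_evalWord_eq hg GorinLin.t₁.braid
  have hpow : ∀ (u : List A) (m : ℕ),
      evalWord g (List.replicate m u).flatten = evalWord g u ^ m := fun u m => by
    induction m with
    | zero => simp [evalWord]
    | succ m ih => rw [List.replicate_succ, List.flatten_cons, evalWord_append, ih, pow_succ']
  -- Fixed words `x`, `y`, `z` for `t₁⁻¹`, `b`, `t₁` turn the conjugates into inputs `xᵐ y zᵐ` of
  -- linear length.
  refine Logspace.not_logspaceComputable_of_two_pow_le (C := x.length + y.length + z.length)
    (w := fun m => (List.replicate m x).flatten ++ y ++ (List.replicate m z).flatten)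
    (fun m => ?_) (fun m => ?_)
  · simp only [List.length_append, List.length_flatten, List.map_replicate, List.sum_replicate,
      smul_eq_mul]
    nlinarith [Nat.zero_le (m * y.length)]
  · refine (length_of_isHNNNormalForm_conjBraid (m := m) ?_).2
    convert hf _ using 1
    rw [evalWord_append, evalWord_append, hpow, hpow, hx, hy, hz, conjBraid, inv_pow]

end Braid4

instance : Finite Braid4.GorinLin :=
  Finite.of_surjective ![.t, .t₁, .t₂, .a, .b] (by
    rintro (_ | _ | _ | _ | _)
    exacts [⟨0, rfl⟩, ⟨1, rfl⟩, ⟨2, rfl⟩, ⟨3, rfl⟩, ⟨4, rfl⟩])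

/-- Every 4-strand braid has a unique HNN normal form; the normal form of `t₁⁻ᵐ b t₁ᵐ` has length
`Φ^(2m+1) - Φ^(-(2m+1))`, exponential in `m`; and the HNN normal form is not logspace computable,
neither from words in the Gorin–Lin generators and their inverses nor from words over any other
finite alphabet that generates the braid group as a monoid. -/
theorem mainTheorem4 :
    (∀ β : Braid4.B4, ∃! u : List Braid4.Letter, Braid4.IsHNNNormalForm u β) ∧
    (∀ (m : ℕ) (u : List Braid4.Letter),
      Braid4.IsHNNNormalForm u
        ((Braid4.GorinLin.t₁.braid ^ m)⁻¹ * Braid4.GorinLin.b.braid *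
          Braid4.GorinLin.t₁.braid ^ m) →
      (u.length : ℝ) =
        Real.goldenRatio ^ (2 * m + 1) - (Real.goldenRatio ^ (2 * m + 1))⁻¹) ∧
    (¬ ∃ f : List Braid4.Letter → List Braid4.Letter,
      (∀ w, Braid4.IsHNNNormalForm (f w) (Braid4.evalWord Braid4.letterBraid w)) ∧
      Logspace.LogspaceComputable f) ∧
    (∀ (A : Type) [Finite A] (g : A → Braid4.B4), Submonoid.closure (Set.range g) = ⊤ →
      ¬ ∃ f : List A → List Braid4.Letter,
        (∀ w, Braid4.IsHNNNormalForm (f w) (Braid4.evalWord g w)) ∧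
        Logspace.LogspaceComputable f) := by
  refine ⟨Braid4.existsUnique_isHNNNormalForm,
    fun _ _ hu => (Braid4.length_of_isHNNNormalForm_conjBraid hu).1, ?_, ?_⟩
  · rintro ⟨f, hf, hlog⟩
    exact Braid4.not_logspaceComputable_hnnNormalForm Braid4.closure_range_letterBraid hf hlog
  · rintro A _ g hg ⟨f, hf, hlog⟩
    exact Braid4.not_logspaceComputable_hnnNormalForm hg hf hlog
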